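/- **Ordered Yosida duality.** A *compact ordered space* is a compact topological space $X$ with a partial order that is closed in $X\times X$; $\mathsf{CompOrd}$ is the category of compact ordered spaces and continuous order-preserving maps. Let $\mathbb{D}=\{k/2^n : k\in\mathbb{Z},\ n\in\mathbb{N}\}$ be the dyadic rationals, and consider algebras in the signature $\{+,\lor,\land\}\cup\mathbb{D}$ (three binary operations and one constant $\alpha^M$ for each $\alpha\in\mathbb{D}$) with their homomorphisms. A *dyadic commutative distributive $\ell$-monoid* is such an algebra $M$ for which $(M;\lor,\land)$ is a distributive lattice, $(M;+,0^M)$ is a commutative monoid, $+$ distributes over $\lor$ and $\land$, and, with respect to the lattice order: $\alpha\le\beta$ implies $\alpha^M\le\beta^M$; $\alpha^M+\beta^M=(\alpha+\beta)^M$; and for every $x\in M$ there are $\alpha,\beta\in\mathbb{D}$ with $\alpha^M\le x\le\beta^M$. For $x,y\in M$ set $$d_M(x,y)=\inf\{t\in\mathbb{D} : t\ge 0,\ y+(-t)^M\le x\le y+t^M\}.$$ For a compact ordered space $X$, let $C_{\le}(X,\mathbb{R})$ be the algebra of continuous order-preserving functions $X\to\mathbb{R}$ with pointwise operations and the constant functions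 as constants. For every dyadic commutative distributive $\ell$-monoid $M$, the infimum $d_M(x,y)$ is taken over a non-empty set, and hence is finite, for all $x,y \in M$; and if $d_M(x,y)=0$ implies $x=y$ for all $x,y\in M$, then $d_M$ is a metric. Let $\mathsf{Y}$ be the category, with all homomorphisms as morphisms, of the dyadic commutative distributive $\ell$-monoids $M$ that satisfy $d_M(x,y)=0\Rightarrow x=y$ and are Cauchy complete with respect to $d_M$. Then: 1. $\mathsf{CompOrd}$ is dually equivalent to $\mathsf{Y}$: there is an equivalence $\mathsf{CompOrd}^{\mathrm{op}}\simeq\mathsf{Y}$ whose composite with the inclusion of $\mathsf{Y}$ into the category of all algebras in the signature is naturally isomorphic to the functor $C_{\le}(-,\mathbb{R})$, which acts on morphisms by precomposition. 2. An algebra $M$ in the signature $\{+,\lor,\land\}\cup\mathbb{D}$ belongs to $\mathsf{Y}$ if and only if $M$ is isomorphic to $C_{\le}(X,\mathbb{R})$ for some compact ordered space $X$. -/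

import Mathlib

open CategoryTheory

universe u

namespace OrderedYosida

/-! ### Compact ordered spaces -/

/-- A compact ordered space: a compact topological space with a partial order
that is closed in the product `X × X`. -/
structure CompOrd : Type (u + 1) where
  carrier : Type u
  [top : TopologicalSpace carrier]
  [order : PartialOrder carrier]
  [compact : CompactSpace carrier]
  [closed : OrderClosedTopology carrier]

namespace CompOrd

instance : CoeSort CompOrd.{u} (Type u) := ⟨CompOrd.carrier⟩

attribute [instance] CompOrd.top CompOrd.order CompOrd.compact CompOrd.closed

/-- The category of compact ordered spaces and continuous order-preserving maps. -/
instance : Category.{u} CompOrd.{u} where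
  Hom X Y := X →Co Y
  id X := ContinuousOrderHom.id X
  comp f g := ContinuousOrderHom.comp g f

end CompOrd

/-! ### Algebras in the signature `{+, ⊔, ⊓} ∪ 𝔻` -/

/-- The dyadic rationals `k / 2 ^ n`, as a subring of the reals. -/
def dyadics : Subring ℝ where
  carrier := {x | ∃ (k : ℤ) (n : ℕ), x = (k : ℝ) / 2 ^ n}
  zero_mem' := ⟨0, 0, by simp⟩
  one_mem' := ⟨1, 0, by simp⟩
  add_mem' := by
    rintro _ _ ⟨k, n, rfl⟩ ⟨l, m, rfl⟩
    refine ⟨k * 2 ^ m + l * 2 ^ n, n + m, ?_⟩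
    push_cast
    field_simp
    ring
  mul_mem' := by
    rintro _ _ ⟨k, n, rfl⟩ ⟨l, m, rfl⟩
    refine ⟨k * l, n + m, ?_⟩
    push_cast
    field_simp
    ring
  neg_mem' := by
    rintro _ ⟨k, n, rfl⟩
    exact ⟨-k, n, by push_cast; ring⟩

/-- The operations of an algebra in the signature `{+, ⊔, ⊓} ∪ 𝔻`: three binary operations,
and a constant for each dyadic rational. No axioms are imposed. -/
class DyadicOps (M : Type u) extends Add M, Max M, Min M where
  /-- The interpretation of the constant symbols. -/
  const : dyadics → M

/-- A homomorphism of algebras in the signature `{+, ⊔, ⊓} ∪ 𝔻`. -/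
@[ext]
structure DyadicHom (M N : Type u) [DyadicOps M] [DyadicOps N] where
  toFun : M → N
  map_add : ∀ x y, toFun (x + y) = toFun x + toFun y
  map_sup : ∀ x y, toFun (x ⊔ y) = toFun x ⊔ toFun y
  map_inf : ∀ x y, toFun (x ⊓ y) = toFun x ⊓ toFun y
  map_const : ∀ t, toFun (DyadicOps.const t) = DyadicOps.const t

/-- An algebra in the signature `{+, ⊔, ⊓} ∪ 𝔻`. -/
structure DyadicAlg : Type (u + 1) where
  carrier : Type u
  [ops : DyadicOps carrier]

namespace DyadicAlg

instance : CoeSort DyadicAlg.{u} (Type u) := ⟨DyadicAlg.carrier⟩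

attribute [instance] DyadicAlg.ops

/-- The category of all algebras in the signature `{+, ⊔, ⊓} ∪ 𝔻` and homomorphisms. -/
instance : Category.{u} DyadicAlg.{u} where
  Hom M N := DyadicHom M N
  id M := ⟨id, fun _ _ => rfl, fun _ _ => rfl, fun _ _ => rfl, fun _ => rfl⟩
  comp f g :=
    ⟨g.toFun ∘ f.toFun,
     fun x y => by simp [f.map_add, g.map_add],
     fun x y => by simp [f.map_sup, g.map_sup],
     fun x y => by simp [f.map_inf, g.map_inf],
     fun t => by simp [f.map_const, g.map_const]⟩

end DyadicAlg

/-! ### Dyadic commutative distributive `ℓ`-monoids -/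

/-- A commutative distributive lattice-ordered monoid with neutral element `zero`. -/
structure IsCommDistribLMonoid (M : Type u) [Add M] [Max M] [Min M] (zero : M) : Prop where
  sup_comm : ∀ x y : M, x ⊔ y = y ⊔ x
  sup_assoc : ∀ x y z : M, (x ⊔ y) ⊔ z = x ⊔ (y ⊔ z)
  inf_comm : ∀ x y : M, x ⊓ y = y ⊓ x
  inf_assoc : ∀ x y z : M, (x ⊓ y) ⊓ z = x ⊓ (y ⊓ z)
  sup_inf_self : ∀ x y : M, x ⊔ (x ⊓ y) = x
  inf_sup_self : ∀ x y : M, x ⊓ (x ⊔ y) = x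
  inf_sup_left : ∀ x y z : M, x ⊓ (y ⊔ z) = (x ⊓ y) ⊔ (x ⊓ z)
  add_assoc : ∀ x y z : M, (x + y) + z = x + (y + z)
  add_zero : ∀ x : M, x + zero = x
  zero_add : ∀ x : M, zero + x = x
  add_comm : ∀ x y : M, x + y = y + x
  add_sup : ∀ x y z : M, x + (y ⊔ z) = (x + y) ⊔ (x + z)
  sup_add : ∀ x y z : M, (x ⊔ y) + z = (x + z) ⊔ (y + z)
  add_inf : ∀ x y z : M, x + (y ⊓ z) = (x + y) ⊓ (x + z)
  inf_add : ∀ x y z : M, (x ⊓ y) + z = (x + z) ⊓ (y + z)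

section

variable {M : Type u} [DyadicOps M]

/-- The lattice order of an algebra: `x ≤ y` means `x ⊓ y = x`. -/
def Le (x y : M) : Prop := x ⊓ y = x

variable (M) in
/-- Dyadic commutative distributive `ℓ`-monoids. -/
structure IsDyadicCDLMonoid : Prop where
  isCommDistribLMonoid : IsCommDistribLMonoid M (DyadicOps.const 0)
  const_mono : ∀ s t : dyadics, s ≤ t → Le (DyadicOps.const s : M) (DyadicOps.const t)
  const_add : ∀ s t : dyadics,
    (DyadicOps.const s + DyadicOps.const t : M) = DyadicOps.const (s + t)
  bounded : ∀ x : M, ∃ s t : dyadics, Le (DyadicOps.const s) x ∧ Le x (DyadicOps.const t)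

/-- The set of dyadic rationals `t ≥ 0` such that `y + (-t) ≤ x ≤ y + t`. -/
def distSet (x y : M) : Set ℝ :=
  {r | ∃ t : dyadics, (t : ℝ) = r ∧ 0 ≤ t ∧
    Le (y + DyadicOps.const (-t)) x ∧ Le x (y + DyadicOps.const t)}

/-- The intrinsic distance: the infimum of the dyadic rationals `t ≥ 0` such that
`y + (-t) ≤ x ≤ y + t`. -/
noncomputable def intDist (x y : M) : ℝ := sInf (distSet x y)

variable (M) in
/-- `d(x, y) = 0` implies `x = y`. -/
def IsSeparated : Prop := ∀ x y : M, intDist x y = 0 → x = y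

variable (M) in
/-- Every Cauchy sequence for the intrinsic distance converges. -/
def IsCauchyComplete : Prop :=
  ∀ a : ℕ → M,
    (∀ ε : ℝ, 0 < ε → ∃ N : ℕ, ∀ m ≥ N, ∀ n ≥ N, intDist (a m) (a n) < ε) →
    ∃ x : M, ∀ ε : ℝ, 0 < ε → ∃ N : ℕ, ∀ n ≥ N, intDist (a n) x < ε

end

/-- The algebras on the algebraic side of the duality: dyadic commutative distributive
`ℓ`-monoids on which the intrinsic distance separates elements and is Cauchy complete. -/
def IsYosida : ObjectProperty DyadicAlg.{u} := fun M =>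
  IsDyadicCDLMonoid M ∧ IsSeparated M ∧ IsCauchyComplete M

/-! ### The functor of real-valued continuous order-preserving functions -/

/-- The pointwise operations on the set of continuous order-preserving functions `X → ℝ`. -/
instance functionOps (X : CompOrd.{u}) : DyadicOps (X →Co ℝ) where
  add f g := ⟨⟨fun x => f x + g x, fun _ _ h => add_le_add (f.monotone' h) (g.monotone' h)⟩,
    f.continuous_toFun.add g.continuous_toFun⟩
  max f g := ⟨⟨fun x => max (f x) (g x), fun _ _ h => max_le_max (f.monotone' h) (g.monotone' h)⟩,
    f.continuous_toFun.max g.continuous_toFun⟩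
  min f g := ⟨⟨fun x => min (f x) (g x), fun _ _ h => min_le_min (f.monotone' h) (g.monotone' h)⟩,
    f.continuous_toFun.min g.continuous_toFun⟩
  const t := ⟨⟨fun _ => (t : ℝ), fun _ _ _ => le_rfl⟩, continuous_const⟩

/-- The algebra `C_≤(X, ℝ)` of continuous order-preserving functions from `X` to `ℝ`. -/
def functionAlg (X : CompOrd.{u}) : DyadicAlg.{u} := ⟨X →Co ℝ⟩

/-- The contravariant functor `C_≤(-, ℝ)`, which sends `f` to precomposition with `f`. -/
def functionFunctor : CompOrd.{u}ᵒᵖ ⥤ DyadicAlg.{u} where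
  obj X := functionAlg X.unop
  map {X Y} f :=
    { toFun := fun g : X.unop →Co ℝ => (ContinuousOrderHom.comp g f.unop : Y.unop →Co ℝ)
      map_add := fun _ _ => rfl
      map_sup := fun _ _ => rfl
      map_inf := fun _ _ => rfl
      map_const := fun _ => rfl }

end OrderedYosida

namespace OrderedYosida

/-! ### The ordered Urysohn lemma -/

section Urysohn

open Set Topology

variable {X : Type u} [TopologicalSpace X] [PartialOrder X] [CompactSpace X]
  [OrderClosedTopology X]

/-! The functor `functionFunctor` lands in `IsYosida`; it is shown to be fully faithful with
essential image exactly that class.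

Fidelity rests on an ordered Urysohn lemma (`exists_continuousOrderHom_lt`): monotone continuous
functions detect the order of X. For fullness, a homomorphism followed by evaluation at a point is a
real-valued homomorphism, and compactness makes every such homomorphism an evaluation
(`exists_eq_eval`).

For essential surjectivity, M is represented on the compact ordered space of its homomorphisms to
the reals. There are enough of them: if x is not below y + t, a prime ideal J containing y + t but
not x induces a total preorder on M compatible with the operations (`isTotalQuotient_traceLE`), and
Dedekind cuts along the constants turn it into a real-valued homomorphism
(`exists_isRealHom_of_not_le`). Hence `gelfand` is injective on separated M. A lattice
Stone–Weierstrass argument (`exists_gelfand_near`) makes its image uniformly dense, and Cauchy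
completeness makes it surjective. -/

theorem isClosed_upperClosure_of_compact {s : Set X} (hs : IsClosed s) :
    IsClosed (upperClosure s : Set X) := by
  -- The upper closure is the projection of this closed set along a compact factor.
  have h : IsClosed {p : X × X | p.1 ∈ s ∧ p.1 ≤ p.2} :=
    (hs.preimage continuous_fst).inter OrderClosedTopology.isClosed_le'
  convert isClosedMap_snd_of_compactSpace _ h using 1
  ext x
  simp [mem_upperClosure]

theorem isClosed_lowerClosure_of_compact {s : Set X} (hs : IsClosed s) :
    IsClosed (lowerClosure s : Set X) := by
  have h : IsClosed {p : X × X | p.2 ∈ s ∧ p.1 ≤ p.2} :=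
    (hs.preimage continuous_snd).inter OrderClosedTopology.isClosed_le'
  convert isClosedMap_fst_of_compactSpace _ h using 1
  ext x
  simp [mem_lowerClosure]

/-- In a compact ordered space, closed sets inside open upper sets can be interpolated by
open upper sets. -/
theorem exists_isOpen_isUpperSet_between {c u : Set X} (hc : IsClosed c) (hu : IsUpperSet u)
    (hu' : IsOpen u) (hcu : c ⊆ u) :
    ∃ v : Set X, IsOpen v ∧ c ⊆ v ∧ closure v ⊆ u ∧ IsUpperSet v := by
  obtain ⟨w, hw, hcw, hwu⟩ := normal_exists_closure_subset (isClosed_upperClosure_of_compact hc)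
    hu' (upperClosure_min hcu hu)
  -- The largest upper set inside w. It contains c because w contains the whole upper closure of c.
  refine ⟨(lowerClosure wᶜ : Set X)ᶜ,
    (isClosed_lowerClosure_of_compact hw.isClosed_compl).isOpen_compl, ?_, ?_,
    (lowerClosure wᶜ).lower.compl⟩
  · intro x hx hxl
    obtain ⟨y, hy, hxy⟩ := mem_lowerClosure.1 hxl
    exact hy (hcw (mem_upperClosure.2 ⟨x, hx, hxy⟩))
  · refine (closure_mono ?_).trans hwu
    rw [compl_subset_comm]
    exact subset_lowerClosure

/-- Each approximant is an iterated average of indicators of complements of upper sets. -/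
theorem antitone_approx {X : Type u} [TopologicalSpace X] [PartialOrder X]
    (c : Urysohns.CU fun _ u : Set X => IsUpperSet u) (n : ℕ) :
    Antitone (c.approx n) := by
  induction n generalizing c with
  | zero =>
    intro x y hxy
    simp only [Urysohns.CU.approx]
    by_cases hx : x ∈ c.U
    · have hy : y ∈ c.U := c.P_C_U hxy hx
      simp [hx, hy]
    · rw [indicator_of_mem (show x ∈ c.Uᶜ from hx)]
      exact indicator_apply_le' (fun _ => le_rfl) fun _ => zero_le_one
  | succ n ih =>
    intro x y hxy
    simp only [Urysohns.CU.approx]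
    exact midpoint_le_midpoint (ih _ hxy) (ih _ hxy)

/-- Continuous order-preserving real functions on a compact ordered space detect the order. -/
theorem exists_continuousOrderHom_lt {x y : X} (hxy : ¬ x ≤ y) : ∃ f : X →Co ℝ, f y < f x := by
  let c : Urysohns.CU fun _ u : Set X => IsUpperSet u :=
    { C := {x}
      U := (Iic y)ᶜ
      P_C_U := (isLowerSet_Iic y).compl
      closed_C := isClosed_singleton
      open_U := isClosed_Iic.isOpen_compl
      subset := by simpa using hxy
      hP := by
        intro c u hc hu hu' hcu
        obtain ⟨v, hv, hcv, hvu, hv'⟩ := exists_isOpen_isUpperSet_between hc hu hu' hcu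
        exact ⟨v, hv, hcv, hvu, hv', hu⟩ }
  -- The Urysohn function is antitone, 0 at x and 1 at y, so its negative is the monotone function
  -- wanted.
  refine ⟨⟨⟨fun z => -c.lim z, fun a b hab => neg_le_neg ?_⟩, c.continuous_lim.neg⟩, ?_⟩
  · exact ciSup_mono (c.bddAbove_range_approx a) fun n => antitone_approx c n hab
  · change -c.lim y < -c.lim x
    rw [c.lim_of_mem_C x rfl, c.lim_of_notMem_U y (by simp [c])]
    norm_num

end Urysohn

/-! ### Dyadic rationals -/

theorem exists_dyadic_btwn {a b : ℝ} (h : a < b) : ∃ t : dyadics, a < t ∧ (t : ℝ) < b := by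
  obtain ⟨n, hn⟩ := exists_pow_lt_of_lt_one (sub_pos.2 h) (by norm_num : (1 / 2 : ℝ) < 1)
  have h2 : (0 : ℝ) < 2 ^ n := by positivity
  rw [one_div, inv_pow, inv_lt_iff_one_lt_mul₀ h2] at hn
  refine ⟨⟨((⌊a * 2 ^ n⌋ + 1 : ℤ) : ℝ) / 2 ^ n, _, n, rfl⟩, ?_, ?_⟩
  · rw [lt_div_iff₀ h2]
    push_cast
    exact Int.lt_floor_add_one _
  · rw [div_lt_iff₀ h2]
    push_cast
    linarith [Int.floor_le (a * 2 ^ n)]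

theorem exists_dyadic_gt (a : ℝ) : ∃ t : dyadics, a < t :=
  (exists_dyadic_btwn (lt_add_one a)).imp fun _ h => h.1

theorem exists_dyadic_lt (a : ℝ) : ∃ t : dyadics, (t : ℝ) < a :=
  (exists_dyadic_btwn (sub_one_lt a)).imp fun _ h => h.2

/-! ### The order and the monoid structure -/

section Monoid

variable {M : Type u} [DyadicOps M]

open DyadicOps

theorem IsCommDistribLMonoid.inf_self {N : Type u} [Add N] [Max N] [Min N] {zero : N}
    (H : IsCommDistribLMonoid N zero) (x : N) : x ⊓ x = x := by
  exact (congrArg (x ⊓ ·) (H.sup_inf_self x x).symm).trans (H.inf_sup_self x (x ⊓ x))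

theorem nonneg_of_mem_distSet {x y : M} {r : ℝ} (hr : r ∈ distSet x y) : 0 ≤ r := by
  obtain ⟨t, rfl, ht, -⟩ := hr
  exact ht

theorem bddBelow_distSet (x y : M) : BddBelow (distSet x y) :=
  ⟨0, fun _ => nonneg_of_mem_distSet⟩

theorem intDist_nonneg (x y : M) : 0 ≤ intDist x y :=
  Real.sInf_nonneg fun _ => nonneg_of_mem_distSet

instance [h : Fact (IsDyadicCDLMonoid M)] : DistribLattice M where
  le := Le
  sup := max
  inf := min
  le_refl x :=
    h.out.isCommDistribLMonoid.inf_self x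
  le_trans x y z hxy hyz := by
    have H := h.out.isCommDistribLMonoid
    change x ⊓ z = x
    rw [← show x ⊓ y = x from hxy, H.inf_assoc, show y ⊓ z = y from hyz]
  le_antisymm x y hxy hyx := by
    have H := h.out.isCommDistribLMonoid
    rw [← show x ⊓ y = x from hxy, H.inf_comm, show y ⊓ x = y from hyx]
  le_sup_left x y := h.out.isCommDistribLMonoid.inf_sup_self x y
  le_sup_right x y := by
    have H := h.out.isCommDistribLMonoid
    change y ⊓ (x ⊔ y) = y
    rw [H.sup_comm, H.inf_sup_self]
  sup_le x y z hxz hyz := by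
    have H := h.out.isCommDistribLMonoid
    change (x ⊔ y) ⊓ z = x ⊔ y
    rw [H.inf_comm, H.inf_sup_left, H.inf_comm z, H.inf_comm z,
      show x ⊓ z = x from hxz, show y ⊓ z = y from hyz]
  inf_le_left x y := by
    have H := h.out.isCommDistribLMonoid
    change (x ⊓ y) ⊓ x = x ⊓ y
    rw [H.inf_comm, ← H.inf_assoc, H.inf_self]
  inf_le_right x y := by
    have H := h.out.isCommDistribLMonoid
    change (x ⊓ y) ⊓ y = x ⊓ y
    rw [H.inf_assoc, H.inf_self]
  le_inf x y z hxy hxz := by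
    have H := h.out.isCommDistribLMonoid
    change x ⊓ (y ⊓ z) = x
    rw [← H.inf_assoc, show x ⊓ y = x from hxy, show x ⊓ z = x from hxz]
  le_sup_inf x y z := by
    have H := h.out.isCommDistribLMonoid
    change ((x ⊔ y) ⊓ (x ⊔ z)) ⊓ (x ⊔ (y ⊓ z)) = (x ⊔ y) ⊓ (x ⊔ z)
    -- The axioms contain only one distributive law; its dual follows by expansion and absorption.
    have e : (x ⊔ y) ⊓ (x ⊔ z) = x ⊔ (y ⊓ z) := by
      rw [H.inf_sup_left, H.inf_comm (x ⊔ y) x, H.inf_sup_self, H.inf_comm (x ⊔ y) z,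
        H.inf_sup_left, ← H.sup_assoc, H.inf_comm z x, H.sup_inf_self, H.inf_comm z y]
    rw [e, H.inf_self]

instance [Fact (IsDyadicCDLMonoid M)] : Zero M := ⟨const 0⟩

instance [h : Fact (IsDyadicCDLMonoid M)] : AddCommMonoid M where
  add_assoc := h.out.isCommDistribLMonoid.add_assoc
  zero_add := h.out.isCommDistribLMonoid.zero_add
  add_zero := h.out.isCommDistribLMonoid.add_zero
  add_comm := h.out.isCommDistribLMonoid.add_comm
  nsmul := nsmulRec

variable [h : Fact (IsDyadicCDLMonoid M)]

theorem add_inf_eq (x y z : M) : x + (y ⊓ z) = (x + y) ⊓ (x + z) :=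
  h.out.isCommDistribLMonoid.add_inf x y z

theorem sup_add_eq (x y z : M) : (x ⊔ y) + z = (x + z) ⊔ (y + z) :=
  h.out.isCommDistribLMonoid.sup_add x y z

theorem inf_add_eq (x y z : M) : (x ⊓ y) + z = (x + z) ⊓ (y + z) :=
  h.out.isCommDistribLMonoid.inf_add x y z

theorem le_iff_le {x y : M} : Le x y ↔ x ≤ y := Iff.rfl

instance : IsOrderedAddMonoid M where
  add_le_add_left x y hxy z := by
    rw [← inf_eq_left, ← inf_add_eq, inf_eq_left.2 hxy]

theorem const_zero : (const 0 : M) = 0 := rfl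

theorem const_mono {s t : dyadics} (hst : s ≤ t) : (const s : M) ≤ const t :=
  h.out.const_mono s t hst

theorem const_add_const (s t : dyadics) : (const s + const t : M) = const (s + t) :=
  h.out.const_add s t

theorem exists_const_le (x : M) : ∃ s : dyadics, const s ≤ x :=
  let ⟨s, _, hs, _⟩ := h.out.bounded x
  ⟨s, hs⟩

theorem exists_le_const (x : M) : ∃ s : dyadics, x ≤ const s :=
  let ⟨_, s, _, hs⟩ := h.out.bounded x
  ⟨s, hs⟩

theorem add_const_neg_cancel (x : M) (t : dyadics) : x + const t + const (-t) = x := by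
  rw [add_assoc, const_add_const, add_neg_cancel, const_zero, add_zero]

theorem add_const_neg_cancel' (x : M) (t : dyadics) : x + const (-t) + const t = x := by
  rw [add_assoc, const_add_const, neg_add_cancel, const_zero, add_zero]

/-- Constants are invertible although general elements are not; this puts the two bounds defining
the distance in a symmetric form. -/
theorem add_const_neg_le_iff {x y : M} {t : dyadics} :
    y + const (-t) ≤ x ↔ y ≤ x + const t := by
  constructor <;> intro H
  · have := add_le_add_left H (const t)
    rwa [add_const_neg_cancel'] at this
  · have := add_le_add_left H (const (-t))
    rwa [add_const_neg_cancel] at this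

/-! ### The intrinsic distance -/

theorem mem_distSet {x y : M} {r : ℝ} : r ∈ distSet x y ↔
    ∃ t : dyadics, (t : ℝ) = r ∧ 0 ≤ t ∧ y ≤ x + const t ∧ x ≤ y + const t := by
  simp only [distSet, Set.mem_ofPred_eq, le_iff_le, add_const_neg_le_iff]

theorem distSet_nonempty (x y : M) : (distSet x y).Nonempty := by
  obtain ⟨a, ha⟩ := exists_const_le x
  obtain ⟨b, hb⟩ := exists_le_const x
  obtain ⟨c, hc⟩ := exists_const_le y
  obtain ⟨d, hd⟩ := exists_le_const y
  -- With x between a and b, and y between c and d, the excess of y over x is at most d - a and that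
  -- of x over y at most b - c.
  refine ⟨_, mem_distSet.2 ⟨max 0 (max (d - a) (b - c)), rfl, le_max_left _ _, ?_, ?_⟩⟩
  · calc y ≤ const d := hd
      _ = const a + const (d - a) := by rw [const_add_const, add_sub_cancel]
      _ ≤ _ := add_le_add ha (const_mono ((le_max_left _ _).trans (le_max_right _ _)))
  · calc x ≤ const b := hb
      _ = const c + const (b - c) := by rw [const_add_const, add_sub_cancel]
      _ ≤ _ := add_le_add hc (const_mono ((le_max_right _ _).trans (le_max_right _ _)))

/-- Nonemptiness is what makes `sInf` a genuine infimum here and not its default value 0. -/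
theorem isGLB_intDist (x y : M) : IsGLB (distSet x y) (intDist x y) :=
  isGLB_csInf (distSet_nonempty x y) (bddBelow_distSet x y)

theorem intDist_le {x y : M} {t : dyadics} (ht : 0 ≤ t) (h₁ : y ≤ x + const t)
    (h₂ : x ≤ y + const t) : intDist x y ≤ t :=
  csInf_le (bddBelow_distSet x y) (mem_distSet.2 ⟨t, rfl, ht, h₁, h₂⟩)

theorem exists_of_intDist_lt {x y : M} {r : ℝ} (hr : intDist x y < r) :
    ∃ t : dyadics, 0 ≤ t ∧ (t : ℝ) < r ∧ y ≤ x + const t ∧ x ≤ y + const t := by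
  obtain ⟨_, hs, hsr⟩ := exists_lt_of_csInf_lt (distSet_nonempty x y) hr
  obtain ⟨t, rfl, ht, h₁, h₂⟩ := mem_distSet.1 hs
  exact ⟨t, ht, hsr, h₁, h₂⟩

theorem intDist_self (x : M) : intDist x x = 0 := by
  have hx : x ≤ x + const 0 := by rw [const_zero, add_zero]
  exact le_antisymm (intDist_le le_rfl hx hx) (intDist_nonneg x x)

theorem intDist_comm (x y : M) : intDist x y = intDist y x := by
  have : distSet x y = distSet y x := by
    ext r
    simp only [mem_distSet]
    exact exists_congr fun t => by tauto
  rw [intDist, intDist, this]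

theorem intDist_triangle (x y z : M) : intDist x z ≤ intDist x y + intDist y z := by
  refine le_of_forall_pos_lt_add fun ε hε => ?_
  obtain ⟨s, hs, hs', h₁, h₂⟩ := exists_of_intDist_lt (lt_add_of_pos_right (intDist x y)
    (half_pos hε))
  obtain ⟨t, ht, ht', h₃, h₄⟩ := exists_of_intDist_lt (lt_add_of_pos_right (intDist y z)
    (half_pos hε))
  have := intDist_le (x := x) (y := z) (add_nonneg hs ht)
    (by
      rw [← const_add_const, ← add_assoc]
      exact h₃.trans (add_le_add_left h₁ _))
    (by
      rw [add_comm s, ← const_add_const, ← add_assoc]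
      exact h₂.trans (add_le_add_left h₄ _))
  push_cast at this
  linarith

/-- The intrinsic distance as a metric. -/
noncomputable abbrev intMetricSpace (hs : IsSeparated M) : MetricSpace M where
  dist := intDist
  dist_self := intDist_self
  dist_comm := intDist_comm
  dist_triangle := intDist_triangle
  eq_of_dist_eq_zero := hs _ _

end Monoid

/-! ### Real-valued homomorphisms -/

section RealHom

variable {M : Type u} [DyadicOps M]

open DyadicOps

/-- Homomorphisms from an algebra to the reals. -/
structure IsRealHom (φ : M → ℝ) : Prop where
  map_add : ∀ x y, φ (x + y) = φ x + φ y
  map_sup : ∀ x y, φ (x ⊔ y) = max (φ x) (φ y)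
  map_inf : ∀ x y, φ (x ⊓ y) = min (φ x) (φ y)
  map_const : ∀ t, φ (const t) = t

/-- A total preorder, compatible with the operations, under which distinct constants stay
distinct. -/
structure IsTotalQuotient (r : M → M → Prop) : Prop where
  trans : ∀ {a b c}, r a b → r b c → r a c
  total : ∀ a b, r a b ∨ r b a
  of_le : ∀ {a b}, Le a b → r a b
  add_right : ∀ {a b} c, r a b → r (a + c) (b + c)
  sup : ∀ {a b c}, r a c → r b c → r (a ⊔ b) c
  inf : ∀ {a b c}, r c a → r c b → r c (a ⊓ b)
  of_const : ∀ {s t : dyadics}, r (const s) (const t) → s ≤ t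

/-- The real number approximated from below by the constants. -/
noncomputable def cutValue (r : M → M → Prop) (a : M) : ℝ :=
  sSup {x | ∃ s : dyadics, (s : ℝ) = x ∧ r (const s) a}

variable [Fact (IsDyadicCDLMonoid M)]

theorem IsRealHom.mono {φ : M → ℝ} (hφ : IsRealHom φ) {a b : M} (hab : a ≤ b) : φ a ≤ φ b := by
  have := hφ.map_inf a b
  rw [inf_eq_left.2 hab] at this
  exact min_eq_left_iff.1 this.symm

theorem IsRealHom.map_nsmul {φ : M → ℝ} (hφ : IsRealHom φ) (n : ℕ) (a : M) :
    φ (n • a) = n * φ a := by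
  induction n with
  | zero =>
    rw [zero_nsmul, ← const_zero, hφ.map_const]
    simp
  | succ n ih =>
    rw [succ_nsmul, hφ.map_add, ih]
    push_cast
    ring

theorem IsRealHom.map_nsmul_add_const_neg {φ : M → ℝ} (hφ : IsRealHom φ) (n : ℕ) (a : M)
    (t : dyadics) : φ (n • (a + const (-t))) = n * (φ a - t) := by
  rw [hφ.map_nsmul, hφ.map_add, hφ.map_const]
  push_cast
  ring

theorem IsRealHom.abs_sub_le_intDist {φ : M → ℝ} (hφ : IsRealHom φ) (a b : M) :
    |φ a - φ b| ≤ intDist a b := by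
  refine le_of_forall_pos_lt_add fun ε hε => ?_
  obtain ⟨t, -, ht, h₁, h₂⟩ := exists_of_intDist_lt (lt_add_of_pos_right (intDist a b) hε)
  have h₁' := hφ.mono h₁
  have h₂' := hφ.mono h₂
  rw [hφ.map_add, hφ.map_const] at h₁' h₂'
  refine lt_of_le_of_lt (abs_le.2 ⟨?_, ?_⟩) ht <;> linarith

namespace IsTotalQuotient

variable {r : M → M → Prop} (hr : IsTotalQuotient r)

include hr

theorem bddAbove (a : M) : BddAbove {x : ℝ | ∃ s : dyadics, (s : ℝ) = x ∧ r (const s) a} := by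
  obtain ⟨t, ht⟩ := exists_le_const a
  refine ⟨t, ?_⟩
  rintro _ ⟨s, rfl, hs⟩
  exact hr.of_const (hr.trans hs (hr.of_le ht))

theorem nonempty (a : M) : {x : ℝ | ∃ s : dyadics, (s : ℝ) = x ∧ r (const s) a}.Nonempty := by
  obtain ⟨t, ht⟩ := exists_const_le a
  exact ⟨t, t, rfl, hr.of_le ht⟩

theorem le_cutValue {s : dyadics} {a : M} (h : r (const s) a) : (s : ℝ) ≤ cutValue r a :=
  le_csSup (hr.bddAbove a) ⟨s, rfl, h⟩

theorem cutValue_le {s : dyadics} {a : M} (h : r a (const s)) : cutValue r a ≤ s := by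
  refine csSup_le (hr.nonempty a) ?_
  rintro _ ⟨t, rfl, ht⟩
  exact hr.of_const (hr.trans ht h)

theorem rel_of_lt_cutValue {s : dyadics} {a : M} (h : (s : ℝ) < cutValue r a) :
    r (const s) a := by
  obtain ⟨_, ⟨t, rfl, ht⟩, hst⟩ := exists_lt_of_lt_csSup (hr.nonempty a) h
  exact hr.trans (hr.of_le (const_mono (show s ≤ t from hst.le))) ht

theorem rel_of_cutValue_lt {s : dyadics} {a : M} (h : cutValue r a < s) : r a (const s) :=
  (hr.total a (const s)).resolve_right fun h' => (hr.le_cutValue h').not_gt h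

theorem cutValue_mono {a b : M} (h : r a b) : cutValue r a ≤ cutValue r b := by
  refine csSup_le (hr.nonempty a) ?_
  rintro _ ⟨t, rfl, ht⟩
  exact hr.le_cutValue (hr.trans ht h)

theorem add {a b c d : M} (hab : r a b) (hcd : r c d) : r (a + c) (b + d) := by
  refine hr.trans (hr.add_right c hab) ?_
  rw [add_comm b, add_comm b]
  exact hr.add_right b hcd

/-- Addition is squeezed between sums of nearby dyadic constants; by totality, a join or meet is
equivalent to one of its two arguments. -/
theorem isRealHom : IsRealHom (cutValue r) where
  map_const t := by
    have h : r (const t) (const t) := hr.of_le (le_refl (const t : M))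
    exact le_antisymm (hr.cutValue_le h) (hr.le_cutValue h)
  map_add a b := by
    apply le_antisymm <;> refine le_of_forall_pos_lt_add fun ε hε => ?_
    · obtain ⟨s, hs, hs'⟩ := exists_dyadic_btwn (lt_add_of_pos_right (cutValue r a) (half_pos hε))
      obtain ⟨t, ht, ht'⟩ := exists_dyadic_btwn (lt_add_of_pos_right (cutValue r b) (half_pos hε))
      have := hr.add (hr.rel_of_cutValue_lt hs) (hr.rel_of_cutValue_lt ht)
      rw [const_add_const] at this
      have := hr.cutValue_le this
      push_cast at this
      linarith
    · obtain ⟨s, hs, hs'⟩ := exists_dyadic_btwn (sub_lt_self (cutValue r a) (half_pos hε))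
      obtain ⟨t, ht, ht'⟩ := exists_dyadic_btwn (sub_lt_self (cutValue r b) (half_pos hε))
      have := hr.add (hr.rel_of_lt_cutValue hs') (hr.rel_of_lt_cutValue ht')
      rw [const_add_const] at this
      have := hr.le_cutValue this
      push_cast at this
      linarith
  map_sup a b := by
    have hl := hr.cutValue_mono (hr.of_le (le_sup_left : a ≤ a ⊔ b))
    have hr' := hr.cutValue_mono (hr.of_le (le_sup_right : b ≤ a ⊔ b))
    refine le_antisymm ?_ (max_le hl hr')
    rcases hr.total a b with h | h
    · exact (hr.cutValue_mono (hr.sup h (hr.of_le (le_refl b)))).trans (le_max_right _ _)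
    · exact (hr.cutValue_mono (hr.sup (hr.of_le (le_refl a)) h)).trans (le_max_left _ _)
  map_inf a b := by
    have hl := hr.cutValue_mono (hr.of_le (inf_le_left : a ⊓ b ≤ a))
    have hr' := hr.cutValue_mono (hr.of_le (inf_le_right : a ⊓ b ≤ b))
    refine le_antisymm (le_min hl hr') ?_
    rcases hr.total a b with h | h
    · exact (min_le_left _ _).trans (hr.cutValue_mono (hr.inf (hr.of_le (le_refl a)) h))
    · exact (min_le_right _ _).trans (hr.cutValue_mono (hr.inf h (hr.of_le (le_refl b))))

end IsTotalQuotient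

/-! ### Prime ideals and totally ordered quotients -/

open Order

/-- Both sides are compared with (a ⊔ b) + (z ⊓ w). This inequality replaces subtraction in proving
that `traceLE` is total. -/
theorem inf_add_le_sup_add (a b z w : M) : (a + z) ⊓ (b + w) ≤ (a + w) ⊔ (b + z) :=
  calc (a + z) ⊓ (b + w) ≤ ((a ⊔ b) + z) ⊓ ((a ⊔ b) + w) :=
        inf_le_inf (add_le_add_left le_sup_left _) (add_le_add_left le_sup_right _)
    _ = (a + (z ⊓ w)) ⊔ (b + (z ⊓ w)) := by rw [← add_inf_eq, sup_add_eq]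
    _ ≤ (a + w) ⊔ (b + z) :=
        sup_le_sup (add_le_add_right inf_le_right _) (add_le_add_right inf_le_left _)

/-- The preorder on `M` obtained by comparing the traces of translates on a prime ideal. -/
def traceLE (J : Ideal M) (a b : M) : Prop := ∀ z, b + z ∈ J → a + z ∈ J

theorem const_nsmul (n : ℕ) (t : dyadics) : (n • const t : M) = const (n • t) := by
  induction n with
  | zero => rw [zero_nsmul, zero_nsmul, const_zero]
  | succ n ih => rw [succ_nsmul, succ_nsmul, ih, const_add_const]

theorem isTotalQuotient_traceLE {J : Ideal M} (hJ : J.IsPrime) {x y : M} (hx : x ∉ J)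
    (hy : y ∈ J) : IsTotalQuotient (traceLE J) := by
  have htrans : ∀ {a b c : M}, traceLE J a b → traceLE J b c → traceLE J a c :=
    fun hab hbc z hz => hab z (hbc z hz)
  have hle : ∀ {a b : M}, a ≤ b → traceLE J a b :=
    fun hab z hz => J.lower (add_le_add_left hab z) hz
  have hadd : ∀ {a b : M} (c : M), traceLE J a b → traceLE J (a + c) (b + c) := by
    intro a b c hab z hz
    rw [add_assoc] at hz ⊢
    exact hab _ hz
  refine ⟨htrans, fun a b => ?_, hle, hadd, ?_, ?_, ?_⟩
  · by_contra! H
    simp only [traceLE, not_forall] at H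
    obtain ⟨⟨w, hbw, haw⟩, z, haz, hbz⟩ := H
    -- Incomparability puts the right-hand side in J; primeness then puts a + w or b + z in J,
    -- against the choice of w and z.
    have h := J.lower (inf_add_le_sup_add a b w z) (Ideal.sup_mem haz hbw)
    exact (hJ.mem_or_mem h).elim haw hbz
  · intro a b c hac hbc z hz
    rw [sup_add_eq]
    exact Ideal.sup_mem (hac z hz) (hbc z hz)
  · intro a b c hca hcb z hz
    rw [inf_add_eq] at hz
    exact (hJ.mem_or_mem hz).elim (hca z) (hcb z)
  · intro s t hst
    -- Archimedean argument: if s > t, then s - t and all its multiples are below 0 in the preorder.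
    -- Since x ≤ q ≤ n(s - t) + p for large n and p ≤ y, x would be below y, although y is in J and
    -- x is not.
    by_contra! hts
    obtain ⟨p, hp⟩ := exists_const_le y
    obtain ⟨q, hq⟩ := exists_le_const x
    have hγ : (0 : ℝ) < (s - t : dyadics) := by
      push_cast
      exact sub_pos.2 hts
    have hstep : traceLE J (const (s - t)) (0 : M) := by
      have := hadd (const (-t)) hst
      rwa [const_add_const, const_add_const, add_neg_cancel, const_zero, ← sub_eq_add_neg]
        at this
    have hn : ∀ n : ℕ, traceLE J (n • const (s - t)) (0 : M) := by
      intro n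
      induction n with
      | zero => rw [zero_nsmul]; exact hle le_rfl
      | succ n ih =>
        rw [succ_nsmul]
        refine htrans (hadd _ ih) ?_
        rwa [zero_add]
    obtain ⟨n, hn'⟩ := exists_nat_gt (((q - p : dyadics) : ℝ) / (s - t : dyadics))
    rw [div_lt_iff₀ hγ] at hn'
    have hqp : q ≤ n • (s - t) + p := by
      refine sub_le_iff_le_add.1 (show ((q - p : dyadics) : ℝ) ≤ (n • (s - t) : dyadics) from ?_)
      push_cast at hn' ⊢
      simpa using hn'.le
    have key : traceLE J x y := by
      refine htrans (hle (hq.trans (const_mono hqp))) (htrans ?_ (hle hp))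
      have := hadd (const p) (hn n)
      rwa [const_nsmul, const_add_const, zero_add] at this
    have := key 0
    rw [add_zero, add_zero] at this
    exact hx (this hy)

/-- Real-valued homomorphisms detect the order up to arbitrarily small constants. -/
theorem exists_isRealHom_of_not_le {x y : M} {t : dyadics} (hxy : ¬ x ≤ y + const t) :
    ∃ φ : M → ℝ, IsRealHom φ ∧ φ y + t ≤ φ x := by
  obtain ⟨J, hJ, hyJ, hxJ⟩ := DistribLattice.prime_ideal_of_disjoint_filter_ideal
    (F := PFilter.principal x) (I := Ideal.principal (y + const t)) (by
      rw [Set.disjoint_left]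
      intro z hz hz'
      exact hxy ((PFilter.mem_principal.1 hz).trans (Ideal.mem_principal.1 hz')))
  have hx : x ∉ J := Set.disjoint_left.1 hxJ (PFilter.mem_principal.2 le_rfl)
  have hy : y + const t ∈ J := hyJ (Ideal.mem_principal.2 le_rfl)
  have hr := isTotalQuotient_traceLE hJ hx hy
  refine ⟨_, hr.isRealHom, ?_⟩
  rw [← hr.isRealHom.map_const t, ← hr.isRealHom.map_add]
  -- If x were below y + t in the preorder, testing at z = 0 would put x in J.
  refine hr.cutValue_mono ((hr.total _ _).resolve_right fun H => hx ?_)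
  have := H 0
  rw [add_zero, add_zero] at this
  exact this hy

/-- The hypothesis is strict because passing to cuts collapses infinitesimal differences, so a
failure of the order is seen only as a weak inequality of reals. -/
theorem le_add_const_of_forall {x y : M} {t : dyadics}
    (h : ∀ φ : M → ℝ, IsRealHom φ → φ x < φ y + t) : x ≤ y + const t := by
  by_contra H
  obtain ⟨φ, hφ, hle⟩ := exists_isRealHom_of_not_le H
  exact hle.not_gt (h φ hφ)

theorem intDist_le_of_forall {x y : M} {t : dyadics} (ht : 0 ≤ t)
    (h : ∀ φ : M → ℝ, IsRealHom φ → |φ x - φ y| < t) : intDist x y ≤ t := by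
  refine intDist_le ht ?_ ?_ <;> refine le_add_const_of_forall fun φ hφ => ?_
  · linarith [(abs_lt.1 (h φ hφ)).1]
  · linarith [(abs_lt.1 (h φ hφ)).2]

end RealHom

/-! ### The algebra of continuous order-preserving functions -/

section Functions

open DyadicOps Topology Filter

variable {X : CompOrd.{u}}

theorem le_iff_forall_le {f g : X →Co ℝ} : Le f g ↔ ∀ x, f x ≤ g x :=
  ⟨fun h x => min_eq_left_iff.1 (DFunLike.congr_fun h x),
    fun h => DFunLike.ext _ _ fun x => min_eq_left (h x)⟩

theorem exists_dyadic_forall_le (f : X →Co ℝ) : ∃ t : dyadics, ∀ x, f x ≤ t := by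
  obtain ⟨b, hb⟩ := (isCompact_range f.continuous_toFun).bddAbove
  obtain ⟨t, ht⟩ := exists_dyadic_gt b
  exact ⟨t, fun x => (hb ⟨x, rfl⟩).trans ht.le⟩

theorem exists_dyadic_forall_ge (f : X →Co ℝ) : ∃ t : dyadics, ∀ x, t ≤ f x := by
  obtain ⟨b, hb⟩ := (isCompact_range f.continuous_toFun).bddBelow
  obtain ⟨t, ht⟩ := exists_dyadic_lt b
  exact ⟨t, fun x => ht.le.trans (hb ⟨x, rfl⟩)⟩

theorem isDyadicCDLMonoid_functions : IsDyadicCDLMonoid (X →Co ℝ) where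
  isCommDistribLMonoid :=
    { sup_comm := fun f g => DFunLike.ext _ _ fun x => max_comm (f x) (g x)
      sup_assoc := fun f g h => DFunLike.ext _ _ fun x => max_assoc (f x) (g x) (h x)
      inf_comm := fun f g => DFunLike.ext _ _ fun x => min_comm (f x) (g x)
      inf_assoc := fun f g h => DFunLike.ext _ _ fun x => min_assoc (f x) (g x) (h x)
      sup_inf_self := fun f g => DFunLike.ext _ _ fun x => sup_inf_self (a := f x) (b := g x)
      inf_sup_self := fun f g => DFunLike.ext _ _ fun x => inf_sup_self (a := f x) (b := g x)
      inf_sup_left := fun f g h => DFunLike.ext _ _ fun x => inf_sup_left (f x) (g x) (h x)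
      add_assoc := fun f g h => DFunLike.ext _ _ fun x => add_assoc (f x) (g x) (h x)
      add_zero := fun f => DFunLike.ext _ _ fun x => add_zero (f x)
      zero_add := fun f => DFunLike.ext _ _ fun x => zero_add (f x)
      add_comm := fun f g => DFunLike.ext _ _ fun x => add_comm (f x) (g x)
      add_sup := fun f g h => DFunLike.ext _ _ fun x => (max_add_add_left (f x) (g x) (h x)).symm
      sup_add := fun f g h => DFunLike.ext _ _ fun x => (max_add_add_right (f x) (g x) (h x)).symm
      add_inf := fun f g h => DFunLike.ext _ _ fun x => (min_add_add_left (f x) (g x) (h x)).symm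
      inf_add := fun f g h =>
        DFunLike.ext _ _ fun x => (min_add_add_right (f x) (g x) (h x)).symm }
  const_mono _ _ hst := le_iff_forall_le.2 fun _ => hst
  const_add _ _ := rfl
  bounded f :=
    let ⟨s, hs⟩ := exists_dyadic_forall_ge f
    let ⟨t, ht⟩ := exists_dyadic_forall_le f
    ⟨s, t, le_iff_forall_le.2 hs, le_iff_forall_le.2 ht⟩

instance : Fact (IsDyadicCDLMonoid (X →Co ℝ)) := ⟨isDyadicCDLMonoid_functions⟩

theorem isRealHom_eval (x : X) : IsRealHom fun f : X →Co ℝ => f x where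
  map_add _ _ := rfl
  map_sup _ _ := rfl
  map_inf _ _ := rfl
  map_const _ := rfl

theorem intDist_functions_le {f g : X →Co ℝ} {t : dyadics} (ht : 0 ≤ t)
    (h : ∀ x, |f x - g x| ≤ t) : intDist f g ≤ t := by
  refine intDist_le ht (le_iff_forall_le.2 fun x => ?_) (le_iff_forall_le.2 fun x => ?_)
  · change g x ≤ f x + t
    linarith [(abs_le.1 (h x)).1]
  · change f x ≤ g x + t
    linarith [(abs_le.1 (h x)).2]

theorem isSeparated_functions : IsSeparated (X →Co ℝ) := by
  intro f g h
  refine DFunLike.ext _ _ fun x => sub_eq_zero.1 (abs_nonpos_iff.1 ?_)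
  exact h ▸ (isRealHom_eval x).abs_sub_le_intDist f g

theorem isCauchyComplete_functions : IsCauchyComplete (X →Co ℝ) := by
  intro a ha
  have hc : ∀ x, CauchySeq fun n => a n x := fun x =>
    Metric.cauchySeq_iff.2 fun ε hε => (ha ε hε).imp fun N hN m hm n hn =>
      ((isRealHom_eval x).abs_sub_le_intDist (a m) (a n)).trans_lt (hN m hm n hn)
  choose F hF using fun x => cauchySeq_tendsto_of_complete (hc x)
  have hu : ∀ ε > 0, ∃ N, ∀ n ≥ N, ∀ x, |a n x - F x| ≤ ε := by
    intro ε hε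
    obtain ⟨N, hN⟩ := ha ε hε
    refine ⟨N, fun n hn x => ?_⟩
    refine le_of_tendsto ((tendsto_const_nhds.sub (hF x)).abs) ?_
    filter_upwards [eventually_ge_atTop N] with m hm
    exact ((isRealHom_eval x).abs_sub_le_intDist (a n) (a m)).trans (hN n hn m hm).le
  have hT : TendstoUniformly (fun n x => a n x) F atTop := by
    refine Metric.tendstoUniformly_iff.2 fun ε hε => ?_
    obtain ⟨N, hN⟩ := hu (ε / 2) (half_pos hε)
    filter_upwards [eventually_ge_atTop N] with n hn x
    rw [dist_comm, Real.dist_eq]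
    linarith [hN n hn x]
  refine ⟨⟨⟨F, fun x y hxy => le_of_tendsto_of_tendsto' (hF x) (hF y) fun n =>
    (a n).monotone' hxy⟩, hT.continuous (Frequently.of_forall fun n =>
    (a n).continuous_toFun)⟩, fun ε hε => ?_⟩
  obtain ⟨t, ht, htε⟩ := exists_dyadic_btwn hε
  obtain ⟨N, hN⟩ := hu t ht
  exact ⟨N, fun n hn => (intDist_functions_le ht.le (hN n hn)).trans_lt htε⟩

/-- Every real-valued homomorphism on `C_≤(X, ℝ)` is the evaluation at a point. -/
theorem exists_eq_eval {φ : (X →Co ℝ) → ℝ} (hφ : IsRealHom φ) : ∃ x, ∀ f, φ f = f x := by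
  by_contra! H
  -- If φ differs from every evaluation, each point has a neighbourhood with such a pair; meets of
  -- the f and joins of the g glue pairs over finite unions. Two functions are needed because
  -- monotone functions cannot be negated.
  have key : ∃ f g : X →Co ℝ, 1 ≤ φ f ∧ φ g ≤ -1 ∧
      ∀ x ∈ (Set.univ : Set X), f x ≤ -1 ∨ 1 ≤ g x := by
    refine isCompact_univ.induction_on
      (p := fun s => ∃ f g : X →Co ℝ, 1 ≤ φ f ∧ φ g ≤ -1 ∧ ∀ x ∈ s, f x ≤ -1 ∨ 1 ≤ g x) ?_ ?_ ?_ ?_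
    · refine ⟨const 1, const (-1), ?_, ?_, by simp⟩ <;> rw [hφ.map_const] <;> simp
    · rintro s t hst ⟨f, g, hf, hg, h⟩
      exact ⟨f, g, hf, hg, fun x hx => h x (hst hx)⟩
    · rintro s t ⟨f, g, hf, hg, h⟩ ⟨f', g', hf', hg', h'⟩
      refine ⟨f ⊓ f', g ⊔ g', ?_, ?_, ?_⟩
      · rw [hφ.map_inf]
        exact le_min hf hf'
      · rw [hφ.map_sup]
        exact max_le hg hg'
      · rintro x (hx | hx)
        · exact (h x hx).imp (min_le_left _ _).trans fun h => h.trans (le_max_left _ _)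
        · exact (h' x hx).imp (min_le_right _ _).trans fun h => h.trans (le_max_right _ _)
    · intro x _
      obtain ⟨f, hf⟩ := H x
      rcases hf.lt_or_gt with hlt | hlt
      · obtain ⟨t, ht, ht'⟩ := exists_dyadic_btwn hlt
        -- This n stretches both gaps around t beyond 1, so n(f - t) exceeds 1 at x and is below -1
        -- under φ.
        obtain ⟨n, hn⟩ := exists_nat_gt (max (1 / (t - φ f)) (1 / (f x - t)))
        have h₁ := (le_max_left _ _).trans_lt hn
        have h₂ := (le_max_right _ _).trans_lt hn
        rw [div_lt_iff₀ (by linarith)] at h₁ h₂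
        let G : X →Co ℝ := n • (f + const (-t))
        have hG : ∀ z, G z = n * (f z - t) := fun z =>
          (isRealHom_eval z).map_nsmul_add_const_neg n f t
        have hφG : φ G = n * (φ f - t) := hφ.map_nsmul_add_const_neg n f t
        refine ⟨{z | 1 < G z}, mem_nhdsWithin_of_mem_nhds
          ((isOpen_lt continuous_const G.continuous_toFun).mem_nhds ?_), const 1, G, ?_, ?_,
          fun z hz => Or.inr (le_of_lt hz)⟩
        · change 1 < G x
          rw [hG]
          exact h₂
        · rw [hφ.map_const]
          simp
        · rw [hφG]
          linarith
      · obtain ⟨t, ht, ht'⟩ := exists_dyadic_btwn hlt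
        obtain ⟨n, hn⟩ := exists_nat_gt (max (1 / (φ f - t)) (1 / (t - f x)))
        have h₁ := (le_max_left _ _).trans_lt hn
        have h₂ := (le_max_right _ _).trans_lt hn
        rw [div_lt_iff₀ (by linarith)] at h₁ h₂
        let G : X →Co ℝ := n • (f + const (-t))
        have hG : ∀ z, G z = n * (f z - t) := fun z =>
          (isRealHom_eval z).map_nsmul_add_const_neg n f t
        have hφG : φ G = n * (φ f - t) := hφ.map_nsmul_add_const_neg n f t
        refine ⟨{z | G z < -1}, mem_nhdsWithin_of_mem_nhds
          ((isOpen_lt G.continuous_toFun continuous_const).mem_nhds ?_), G, const (-1), ?_, ?_,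
          fun z hz => Or.inl (le_of_lt hz)⟩
        · change G x < -1
          rw [hG]
          linarith
        · rw [hφG]
          linarith
        · rw [hφ.map_const]
          simp
  obtain ⟨f, g, hf, hg, h⟩ := key
  -- Truncated to [-1, 1], f lies below g everywhere, yet φ sends the truncations to 1 and -1.
  have hle : Le ((f ⊓ const 1) ⊔ const (-1)) ((g ⊓ const 1) ⊔ const (-1)) := by
    refine le_iff_forall_le.2 fun x => ?_
    change max (min (f x) ((1 : dyadics) : ℝ)) ((-1 : dyadics) : ℝ) ≤
      max (min (g x) ((1 : dyadics) : ℝ)) ((-1 : dyadics) : ℝ)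
    push_cast
    rcases h x trivial with h | h
    · exact max_le ((min_le_left _ _).trans (h.trans (le_max_right _ _))) (le_max_right _ _)
    · rw [min_eq_right h]
      exact max_le_max (min_le_right _ _) le_rfl
  have := hφ.mono hle
  rw [hφ.map_sup, hφ.map_inf, hφ.map_sup, hφ.map_inf, hφ.map_const, hφ.map_const] at this
  push_cast at this
  rw [min_eq_right hf, min_eq_left (by linarith), max_eq_right hg] at this
  norm_num at this

theorem isYosida_functionAlg (X : CompOrd.{u}) : IsYosida (functionAlg X) :=
  ⟨isDyadicCDLMonoid_functions, isSeparated_functions, isCauchyComplete_functions⟩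

end Functions

/-! ### The spectrum -/

section Spectrum

open DyadicOps Topology Filter

variable (M : Type u) [DyadicOps M] [Fact (IsDyadicCDLMonoid M)]

/-- Constants bounding each element confine homomorphisms to a product of compact intervals, where
the homomorphism equations are closed conditions. -/
instance compactSpace_isRealHom : CompactSpace {φ : M → ℝ // IsRealHom φ} := by
  choose s hs using exists_const_le (M := M)
  choose t ht using exists_le_const (M := M)
  have hK : IsCompact (Set.univ.pi fun a => Set.Icc (s a : ℝ) (t a) : Set (M → ℝ)) :=
    isCompact_univ_pi fun a => isCompact_Icc
  have hc : IsClosed {φ : M → ℝ | IsRealHom φ} := by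
    have : {φ : M → ℝ | IsRealHom φ} =
        ((⋂ a, ⋂ b, {φ : M → ℝ | φ (a + b) = φ a + φ b}) ∩
          ⋂ a, ⋂ b, {φ : M → ℝ | φ (a ⊔ b) = max (φ a) (φ b)}) ∩
        ((⋂ a, ⋂ b, {φ : M → ℝ | φ (a ⊓ b) = min (φ a) (φ b)}) ∩
          ⋂ r : dyadics, {φ : M → ℝ | φ (const r) = r}) := by
      ext φ
      simp only [Set.mem_inter_iff, Set.mem_iInter, Set.mem_ofPred_eq]
      exact ⟨fun h => ⟨⟨h.map_add, h.map_sup⟩, h.map_inf, h.map_const⟩,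
        fun h => ⟨h.1.1, h.1.2, h.2.1, h.2.2⟩⟩
    rw [this]
    refine ((isClosed_iInter fun a => isClosed_iInter fun b => ?_).inter
      (isClosed_iInter fun a => isClosed_iInter fun b => ?_)).inter
      ((isClosed_iInter fun a => isClosed_iInter fun b => ?_).inter
      (isClosed_iInter fun r => ?_)) <;>
    exact isClosed_eq (by fun_prop) (by fun_prop)
  refine isCompact_iff_compactSpace.1 (hK.of_isClosed_subset hc ?_)
  intro φ hφ a _
  constructor
  · rw [← (hφ : IsRealHom φ).map_const]
    exact IsRealHom.mono hφ (hs a)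
  · rw [← (hφ : IsRealHom φ).map_const]
    exact IsRealHom.mono hφ (ht a)

/-- The compact ordered space of real-valued homomorphisms. -/
def realSpectrum : CompOrd.{u} := ⟨{φ : M → ℝ // IsRealHom φ}⟩

variable {M}

/-- Evaluation of real-valued homomorphisms at an element. -/
def gelfand (a : M) : realSpectrum M →Co ℝ where
  toFun φ := φ.1 a
  monotone' _ _ h := h a
  continuous_toFun := (continuous_apply a).comp continuous_subtype_val

theorem gelfand_apply (a : M) (φ : realSpectrum M) : gelfand a φ = φ.1 a := rfl

theorem gelfand_injective (hs : IsSeparated M) : Function.Injective (gelfand (M := M)) := by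
  intro a b hab
  refine hs a b (le_antisymm (le_of_forall_pos_le_add fun ε hε => ?_) (intDist_nonneg a b))
  obtain ⟨t, ht, htε⟩ := exists_dyadic_btwn hε
  rw [zero_add]
  refine (intDist_le_of_forall ht.le fun φ hφ => ?_).trans htε.le
  have : φ a = φ b := DFunLike.congr_fun hab (⟨φ, hφ⟩ : realSpectrum M)
  rw [this, sub_self, abs_zero]
  exact ht

/-- If g p ≤ g q, a constant suffices. Otherwise p is not below q, so some a is larger at p than at
q; a multiple of a makes the gap large enough, and a constant adjusts the level. -/
theorem exists_apply_gt_apply_lt (g : realSpectrum M →Co ℝ) (p q : realSpectrum M) {ε : ℝ}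
    (hε : 0 < ε) : ∃ a : M, g p - ε < p.1 a ∧ q.1 a < g q + ε := by
  by_cases hpq : g p ≤ g q
  · obtain ⟨t, ht, ht'⟩ := exists_dyadic_btwn (sub_lt_self (g p) hε)
    refine ⟨const t, ?_, ?_⟩
    · rwa [p.2.map_const]
    · rw [q.2.map_const]
      linarith
  · have hle : ¬ p ≤ q := fun h => hpq (g.monotone' h)
    obtain ⟨a, ha⟩ : ∃ a, ¬ p.1 a ≤ q.1 a := not_forall.1 hle
    obtain ⟨n, hn⟩ := exists_nat_gt ((g p - g q) / (p.1 a - q.1 a))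
    rw [div_lt_iff₀ (by linarith)] at hn
    obtain ⟨t, ht, ht'⟩ := exists_dyadic_btwn
      (show g q - n * q.1 a < g q - n * q.1 a + ε by linarith)
    refine ⟨n • a + const t, ?_, ?_⟩
    · rw [p.2.map_add, p.2.map_nsmul, p.2.map_const]
      linarith
    · rw [q.2.map_add, q.2.map_nsmul, q.2.map_const]
      linarith

/-- First half of Stone–Weierstrass: q is fixed and finitely many two-point interpolants are joined
over a cover in p. -/
theorem exists_gelfand_lt_at (g : realSpectrum M →Co ℝ) (q : realSpectrum M) {ε : ℝ}
    (hε : 0 < ε) : ∃ a : M, q.1 a < g q + ε ∧ ∀ p : realSpectrum M, g p - ε < p.1 a := by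
  suffices H : ∃ a : M, q.1 a < g q + ε ∧
      ∀ p ∈ (Set.univ : Set (realSpectrum M)), g p - ε < p.1 a by simpa using H
  refine isCompact_univ.induction_on
    (p := fun s => ∃ a : M, q.1 a < g q + ε ∧ ∀ p ∈ s, g p - ε < p.1 a) ?_ ?_ ?_ ?_
  · obtain ⟨a, -, ha⟩ := exists_apply_gt_apply_lt g q q hε
    exact ⟨a, ha, by simp⟩
  · rintro s t hst ⟨a, ha, h⟩
    exact ⟨a, ha, fun p hp => h p (hst hp)⟩
  · rintro s t ⟨a, ha, h⟩ ⟨b, hb, h'⟩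
    refine ⟨a ⊔ b, ?_, ?_⟩
    · rw [q.2.map_sup]
      exact max_lt ha hb
    · intro p hp
      rw [p.2.map_sup]
      exact hp.elim (fun hp => lt_max_of_lt_left (h p hp)) fun hp => lt_max_of_lt_right (h' p hp)
  · intro p _
    obtain ⟨a, ha, ha'⟩ := exists_apply_gt_apply_lt g p q hε
    exact ⟨{z | g z - ε < gelfand a z}, mem_nhdsWithin_of_mem_nhds
      ((isOpen_lt (g.continuous_toFun.sub continuous_const)
        (gelfand a).continuous_toFun).mem_nhds ha), a, ha', fun z hz => hz⟩

/-- Second half: finitely many elements from the first half are met over a cover in q, which keeps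
the lower bound. -/
theorem exists_gelfand_near (g : realSpectrum M →Co ℝ) {ε : ℝ} (hε : 0 < ε) :
    ∃ a : M, ∀ p : realSpectrum M, |p.1 a - g p| < ε := by
  suffices H : ∃ a : M, (∀ p : realSpectrum M, g p - ε < p.1 a) ∧
      ∀ q ∈ (Set.univ : Set (realSpectrum M)), q.1 a < g q + ε by
    obtain ⟨a, h₁, h₂⟩ := H
    refine ⟨a, fun p => abs_lt.2 ⟨?_, ?_⟩⟩
    · linarith [h₁ p]
    · linarith [h₂ p trivial]
  refine isCompact_univ.induction_on (p := fun s => ∃ a : M,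
    (∀ p : realSpectrum M, g p - ε < p.1 a) ∧ ∀ q ∈ s, q.1 a < g q + ε) ?_ ?_ ?_ ?_
  · obtain ⟨t, ht⟩ := exists_dyadic_forall_le g
    refine ⟨const t, fun p => ?_, by simp⟩
    rw [p.2.map_const]
    linarith [ht p]
  · rintro s t hst ⟨a, ha, h⟩
    exact ⟨a, ha, fun p hp => h p (hst hp)⟩
  · rintro s t ⟨a, ha, h⟩ ⟨b, hb, h'⟩
    refine ⟨a ⊓ b, fun p => ?_, ?_⟩
    · rw [p.2.map_inf]
      exact lt_min (ha p) (hb p)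
    · intro q hq
      rw [q.2.map_inf]
      exact hq.elim (fun hq => min_lt_of_left_lt (h q hq)) fun hq => min_lt_of_right_lt (h' q hq)
  · intro q _
    obtain ⟨a, ha, ha'⟩ := exists_gelfand_lt_at g q hε
    exact ⟨{z | gelfand a z < g z + ε}, mem_nhdsWithin_of_mem_nhds
      ((isOpen_lt (gelfand a).continuous_toFun
        (g.continuous_toFun.add continuous_const)).mem_nhds ha), a, ha', fun z hz => hz⟩

/-- Uniform approximants of g are Cauchy for `intDist`, which real homomorphisms control; these
being 1-Lipschitz, the limit in M takes the values of g. -/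
theorem gelfand_surjective (hc : IsCauchyComplete M) :
    Function.Surjective (gelfand (M := M)) := by
  intro g
  choose a ha using fun n : ℕ =>
    exists_gelfand_near g (Nat.one_div_pos_of_nat (α := ℝ) (n := n))
  have hsmall : ∀ ε : ℝ, 0 < ε → ∃ N : ℕ, ∀ n ≥ N, ∀ p : realSpectrum M,
      |p.1 (a n) - g p| < ε := by
    intro ε hε
    obtain ⟨N, hN⟩ := exists_nat_one_div_lt hε
    exact ⟨N, fun n hn p => (ha n p).trans ((Nat.one_div_le_one_div hn).trans_lt hN)⟩
  obtain ⟨x, hx⟩ := hc a fun ε hε => by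
    obtain ⟨t, ht, htε⟩ := exists_dyadic_btwn hε
    obtain ⟨N, hN⟩ := hsmall (t / 2) (half_pos ht)
    refine ⟨N, fun m hm n hn => (intDist_le_of_forall ht.le fun φ hφ => ?_).trans_lt htε⟩
    have h₁ := abs_lt.1 (hN m hm ⟨φ, hφ⟩)
    have h₂ := abs_lt.1 (hN n hn ⟨φ, hφ⟩)
    exact abs_lt.2 ⟨by linarith, by linarith⟩
  refine ⟨x, DFunLike.ext _ _ fun p => ?_⟩
  rw [gelfand_apply]
  refine eq_of_abs_sub_le_all fun ε hε => ?_
  obtain ⟨N, hN⟩ := hsmall (ε / 2) (half_pos hε)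
  obtain ⟨N', hN'⟩ := hx (ε / 2) (half_pos hε)
  have h₁ := abs_lt.1 (hN (max N N') (le_max_left _ _) p)
  have h₂ := abs_lt.1 ((p.2.abs_sub_le_intDist (a (max N N')) x).trans_lt
    (hN' (max N N') (le_max_right _ _)))
  exact abs_le.2 ⟨by linarith, by linarith⟩

end Spectrum

/-! ### Invariance under isomorphism -/

section Transport

open DyadicOps

variable {M N : Type u} [DyadicOps M] [DyadicOps N]

theorem DyadicHom.le_iff (e : DyadicHom M N) (he : Function.Injective e.toFun) {x y : M} :
    Le x y ↔ Le (e.toFun x) (e.toFun y) := by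
  rw [Le, Le, ← e.map_inf, he.eq_iff]

theorem DyadicHom.isDyadicCDLMonoid (e : DyadicHom M N) (he : Function.Injective e.toFun)
    (h : IsDyadicCDLMonoid N) : IsDyadicCDLMonoid M where
  isCommDistribLMonoid := by
    have H := h.isCommDistribLMonoid
    constructor <;> intros <;> apply he <;>
      simp only [e.map_add, e.map_sup, e.map_inf, e.map_const]
    exacts [H.sup_comm _ _, H.sup_assoc _ _ _, H.inf_comm _ _, H.inf_assoc _ _ _,
      H.sup_inf_self _ _, H.inf_sup_self _ _, H.inf_sup_left _ _ _, H.add_assoc _ _ _,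
      H.add_zero _, H.zero_add _, H.add_comm _ _, H.add_sup _ _ _, H.sup_add _ _ _,
      H.add_inf _ _ _, H.inf_add _ _ _]
  const_mono s t hst := by
    rw [e.le_iff he, e.map_const, e.map_const]
    exact h.const_mono s t hst
  const_add s t := he (by simp only [e.map_add, e.map_const, h.const_add])
  bounded x := by
    obtain ⟨s, t, hs, ht⟩ := h.bounded (e.toFun x)
    refine ⟨s, t, ?_, ?_⟩ <;> rw [e.le_iff he, e.map_const]
    exacts [hs, ht]

theorem DyadicHom.intDist_eq (e : DyadicHom M N) (he : Function.Injective e.toFun) (x y : M) :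
    intDist (e.toFun x) (e.toFun y) = intDist x y := by
  simp only [intDist, distSet, e.le_iff he, e.map_add, e.map_const]

theorem DyadicHom.isCauchyComplete (e : DyadicHom M N) (he : Function.Bijective e.toFun)
    (h : IsCauchyComplete N) : IsCauchyComplete M := by
  intro a ha
  obtain ⟨y, hy⟩ := h (fun n => e.toFun (a n)) (by simpa only [e.intDist_eq he.1] using ha)
  obtain ⟨x, rfl⟩ := he.2 y
  exact ⟨x, by simpa only [e.intDist_eq he.1] using hy⟩

/-- A bijective homomorphism is an isomorphism. -/
noncomputable def isoOfBijective {A B : DyadicAlg.{u}} (e : A ⟶ B)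
    (he : Function.Bijective (DyadicHom.toFun e)) : A ≅ B where
  hom := e
  inv :=
    let E := Equiv.ofBijective _ he
    have hE : ∀ y, DyadicHom.toFun e (E.symm y) = y := E.apply_symm_apply
    { toFun := E.symm
      map_add := fun x y => he.1 (by rw [e.map_add, hE, hE, hE])
      map_sup := fun x y => he.1 (by rw [e.map_sup, hE, hE, hE])
      map_inf := fun x y => he.1 (by rw [e.map_inf, hE, hE, hE])
      map_const := fun t => he.1 (by rw [e.map_const, hE]) }
  hom_inv_id := DyadicHom.ext (funext (Equiv.ofBijective _ he).symm_apply_apply)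
  inv_hom_id := DyadicHom.ext (funext (Equiv.ofBijective _ he).apply_symm_apply)

theorem bijective_of_iso {A B : DyadicAlg.{u}} (e : A ≅ B) :
    Function.Bijective (DyadicHom.toFun e.hom) :=
  Function.bijective_iff_has_inverse.2 ⟨DyadicHom.toFun e.inv,
    fun x => congrFun (congrArg DyadicHom.toFun e.hom_inv_id) x,
    fun x => congrFun (congrArg DyadicHom.toFun e.inv_hom_id) x⟩

theorem IsYosida.of_iso {A B : DyadicAlg.{u}} (e : A ≅ B) (hB : IsYosida B) : IsYosida A := by
  have he := bijective_of_iso e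
  refine ⟨DyadicHom.isDyadicCDLMonoid e.hom he.1 hB.1, fun x y hxy => he.1 (hB.2.1 _ _ ?_),
    DyadicHom.isCauchyComplete e.hom he hB.2.2⟩
  rwa [DyadicHom.intDist_eq e.hom he.1]

end Transport

/-! ### The duality -/

/-- An algebra in `Y` is isomorphic to the algebra of functions on its spectrum. -/
theorem nonempty_iso_functionAlg {M : DyadicAlg.{u}} (hM : IsYosida M) :
    ∃ X : CompOrd.{u}, Nonempty (M ≅ functionAlg X) := by
  have : Fact (IsDyadicCDLMonoid M) := ⟨hM.1⟩
  let e : DyadicHom M (realSpectrum M →Co ℝ) :=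
    { toFun := gelfand
      map_add := fun a b => DFunLike.ext _ _ fun φ => φ.2.map_add a b
      map_sup := fun a b => DFunLike.ext _ _ fun φ => φ.2.map_sup a b
      map_inf := fun a b => DFunLike.ext _ _ fun φ => φ.2.map_inf a b
      map_const := fun t => DFunLike.ext _ _ fun φ => φ.2.map_const t }
  exact ⟨realSpectrum M, ⟨isoOfBijective (B := functionAlg (realSpectrum M)) e
    ⟨gelfand_injective hM.2.1, gelfand_surjective hM.2.2⟩⟩⟩

theorem eq_of_forall_apply_eq {X : CompOrd.{u}} {x y : X} (h : ∀ f : X →Co ℝ, f x = f y) :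
    x = y := by
  by_contra hne
  rcases not_and_or.1 (mt (fun h => le_antisymm h.1 h.2) hne) with hxy | hxy <;>
  obtain ⟨f, hf⟩ := exists_continuousOrderHom_lt hxy
  exacts [hf.ne' (h f), hf.ne (h f)]

/-- Separation of points embeds the compact space X in a power of the reals, so X carries the
initial topology of its monotone continuous functions. -/
theorem continuous_of_forall_comp {Y : Type u} [TopologicalSpace Y] {X : CompOrd.{u}} {F : Y → X}
    (h : ∀ f : X →Co ℝ, Continuous fun y => f (F y)) : Continuous F := by
  let ι : X → (X →Co ℝ) → ℝ := fun x f => f x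
  have hι : Topology.IsClosedEmbedding ι :=
    Continuous.isClosedEmbedding (continuous_pi fun f => f.continuous_toFun)
      fun x y hxy => eq_of_forall_apply_eq fun f => congrFun hxy f
  exact hι.isInducing.continuous_iff.2 (continuous_pi h)

instance : functionFunctor.{u}.Faithful where
  map_injective {X Y f g} h := by
    refine Quiver.Hom.unop_inj (ContinuousOrderHom.ext fun y => eq_of_forall_apply_eq fun k => ?_)
    exact DFunLike.congr_fun (F := Y.unop →Co ℝ) (congrFun (congrArg DyadicHom.toFun h) k) y

instance : functionFunctor.{u}.Full where
  map_surjective {X Y} h := by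
    let H : DyadicHom (X.unop →Co ℝ) (Y.unop →Co ℝ) := h
    have hφ : ∀ y : Y.unop, IsRealHom fun f : X.unop →Co ℝ => H.toFun f y := fun y =>
      { map_add := fun f g => DFunLike.congr_fun (H.map_add f g) y
        map_sup := fun f g => DFunLike.congr_fun (H.map_sup f g) y
        map_inf := fun f g => DFunLike.congr_fun (H.map_inf f g) y
        map_const := fun t => DFunLike.congr_fun (H.map_const t) y }
    -- The dual map sends y to the point whose evaluation is h followed by evaluation at y;
    -- monotonicity and continuity are tested against functions on X.
    choose F hF using fun y => exists_eq_eval (hφ y)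
    let k : Y.unop →Co X.unop :=
      { toFun := F
        monotone' := by
          intro y z hyz
          by_contra hn
          obtain ⟨f, hf⟩ := exists_continuousOrderHom_lt hn
          rw [← hF, ← hF] at hf
          exact hf.not_ge ((H.toFun f).monotone' hyz)
        continuous_toFun := continuous_of_forall_comp fun f => by
          simp only [← hF]
          exact (H.toFun f).continuous_toFun }
    exact ⟨Quiver.Hom.op (X := Y.unop) (Y := X.unop) k,
      DyadicHom.ext (funext fun f => DFunLike.ext (F := Y.unop →Co ℝ) _ _ fun y => (hF y f).symm)⟩

/-- The functor `C_≤(-, ℝ)` with values in the category `Y`. -/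
def yosidaFunctor : CompOrd.{u}ᵒᵖ ⥤ IsYosida.{u}.FullSubcategory :=
  IsYosida.lift functionFunctor fun X => isYosida_functionAlg X.unop

instance : yosidaFunctor.{u}.Full :=
  Functor.Full.of_comp_faithful_iso (IsYosida.liftCompιIso functionFunctor _)

instance : yosidaFunctor.{u}.Faithful :=
  Functor.Faithful.of_comp_iso (IsYosida.liftCompιIso functionFunctor _)

instance : yosidaFunctor.{u}.EssSurj where
  mem_essImage M := by
    obtain ⟨X, ⟨e⟩⟩ := nonempty_iso_functionAlg M.property
    exact ⟨Opposite.op X, ⟨IsYosida.ι.preimageIso e.symm⟩⟩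

instance : yosidaFunctor.{u}.IsEquivalence where

end OrderedYosida

theorem mainTheorem8 :
    (∃ e : OrderedYosida.CompOrd.{u}ᵒᵖ ≌ OrderedYosida.IsYosida.{u}.FullSubcategory,
      Nonempty (e.functor ⋙ OrderedYosida.IsYosida.{u}.ι ≅ OrderedYosida.functionFunctor.{u})) ∧
    (∀ M : OrderedYosida.DyadicAlg.{u},
      OrderedYosida.IsYosida M ↔
        ∃ X : OrderedYosida.CompOrd.{u}, Nonempty (M ≅ OrderedYosida.functionAlg X)) ∧
    (∀ M : OrderedYosida.DyadicAlg.{u}, OrderedYosida.IsDyadicCDLMonoid M →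
      (∀ x y : M, IsGLB (OrderedYosida.distSet x y) (OrderedYosida.intDist x y)) ∧
      (OrderedYosida.IsSeparated M →
        ∃ m : MetricSpace M, ∀ x y : M, m.dist x y = OrderedYosida.intDist x y)) := by
  refine ⟨⟨OrderedYosida.yosidaFunctor.asEquivalence, ⟨Iso.refl _⟩⟩, fun M =>
    ⟨OrderedYosida.nonempty_iso_functionAlg, fun ⟨X, ⟨e⟩⟩ =>
      OrderedYosida.IsYosida.of_iso e (OrderedYosida.isYosida_functionAlg X)⟩, fun M hM => ?_⟩
  have : Fact (OrderedYosida.IsDyadicCDLMonoid M) := ⟨hM⟩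
  exact ⟨OrderedYosida.isGLB_intDist, fun hs =>
    ⟨OrderedYosida.intMetricSpace hs, fun _ _ => rfl⟩⟩
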